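/- For positive integers $p$ and $1\le k\le N$ let $A=(A_{i_1,\dots,i_p})_{1\le i_1,\dots,i_p\le N}$ be an order-$p$ tensor with i.i.d. $\mathcal N(0,1)$ entries, and put $$M^*=\max_{\substack{I_1,\dots,I_p\subset\{1,\dots,N\}\\ |I_1|=\cdots=|I_p|=k}}\ \frac1{k^p}\sum_{i_1\in I_1,\dots,i_p\in I_p}A_{i_1,\dots,i_p},\qquad E_{\max}=\sqrt{\frac{2p}{k^p}\log\binom Nk}.$$ For every $\varepsilon>0$ and every $c<1$ there is a $P^*=P^*(\varepsilon,c)\in\mathbb N$ such that for every fixed $p\ge P^*$ there is a constant $C=C(\varepsilon,c,p)>0$ with the following property. Let $k=k(N)$ be any sequence of integers with $1\le k(N)\le N$ for all large $N$ and $\limsup_{N\to\infty}k(N)/N\le c$ (so both $k=\Theta(N)$ and $k=o(N)$, bounded $k$ included, are allowed). Then for all sufficiently large $N$, $$\mathbb P\bigl[(1-\varepsilon)E_{\max}\le M^*\le E_{\max}\bigr]\ \ge\ 1-\frac{C}{\sqrt{\log\binom{N}{k}}},$$ and in particular this probability tends to $1$ as $N\to\infty$. -/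

import Mathlib

open Filter MeasureTheory ProbabilityTheory
open scoped Topology

/-- The law of an order-`p` tensor `A = (A_{i₁,…,i_p})`, with indices in `Fin N`, whose entries are
i.i.d. standard normal. -/
noncomputable def gaussianTensor (p N : ℕ) : Measure ((Fin p → Fin N) → ℝ) :=
  Measure.pi fun _ => gaussianReal 0 1

/-- The average `k^{-p} ∑_{i₁ ∈ I₁, …, i_p ∈ I_p} A_{i₁,…,i_p}` of the subtensor of `A` indexed by
`I₁ × ⋯ × I_p` (an average when every `I_j` has `k` elements). -/
noncomputable def subtensorAverage {p N : ℕ} (k : ℕ) (A : (Fin p → Fin N) → ℝ)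
    (I : Fin p → Finset (Fin N)) : ℝ :=
  1 / (k : ℝ) ^ p * ∑ i ∈ Fintype.piFinset I, A i

/-- The largest average `M*` of a `k × ⋯ × k` subtensor of `A`. For `k ≤ N` the supremum runs over a
finite non-empty family, so it is a maximum. -/
noncomputable def maxSubtensorAverage {p N : ℕ} (k : ℕ) (A : (Fin p → Fin N) → ℝ) : ℝ :=
  ⨆ I : {I : Fin p → Finset (Fin N) // ∀ j, (I j).card = k}, subtensorAverage k A I.1

/-- `E_max = √((2p / k^p) log (N choose k))`. -/
noncomputable def Emax (p N k : ℕ) : ℝ :=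
  √(2 * (p : ℝ) / (k : ℝ) ^ p * Real.log (N.choose k : ℝ))

/-! Put `n = N.choose k` and `s = √(2 p log n)`. After rescaling by `√(k^p)`, the subtensor averages
are inner products of a standard Gaussian vector with `n^p = exp (s²/2)` unit vectors, and `E_max`
becomes `s`. The upper bound is a union bound: `n^p` Gaussian tails of size at most `exp (-s²/2) /
s` sum to `1/s`, which is the source of the error rate.

The lower bound combines a weak second moment estimate with concentration. The correlation of two
block vectors is a product of `p` relative overlaps. If it exceeds a fixed `η`, then all but a
bounded number `r` of coordinates overlap almost fully, and for large `p` such pairs are a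
negligible fraction. This is where `P*` comes from, while `c < 1` makes the near-balls around a
`k`-set small. The second moment method (`one_le_stdGaussian_real_exists_le_inner_mul`) then shows
only that the maximum reaches `(1 - ε/2) s` with probability at least `exp (-ε² s²/40 - O(s))`, up
to a constant factor.

Gaussian concentration of the maximum (`stdGaussian_max_concentration`) upgrades this. The product
of the probabilities of exceeding `(1 - ε/2) s` and of staying below `(1 - ε) s` is at most `exp
(-ε² s²/20)`. Dividing, the latter probability is `exp (-ε² s²/40 + O(s))`, hence `O(1/s)`. -/

theorem exists_measurable_argmax {α ι : Type*} [MeasurableSpace α] [Finite ι] [Nonempty ι]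
    [MeasurableSpace ι] [DiscreteMeasurableSpace ι] (f : ι → α → ℝ) (hf : ∀ i, Measurable (f i)) :
    ∃ s : α → ι, Measurable s ∧ ∀ x i, f i x ≤ f (s x) x := by
  classical
  have := Fintype.ofFinite ι
  have key : ∀ T : Finset ι, T.Nonempty →
      ∃ s : α → ι, Measurable s ∧ ∀ x, ∀ i ∈ T, f i x ≤ f (s x) x := by
    intro T hT
    induction hT using Finset.Nonempty.cons_induction with
    | singleton a => exact ⟨fun _ => a, measurable_const, by simp⟩
    | cons a T ha hT ih =>
      obtain ⟨s, hs, hmax⟩ := ih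
      have hfs : Measurable fun x => f (s x) x := by
        have : Measurable fun q : ι × α => f q.1 q.2 := measurable_from_prod_countable_right hf
        exact this.comp (hs.prodMk measurable_id)
      refine ⟨fun x => if f (s x) x ≤ f a x then a else s x,
        Measurable.ite (measurableSet_le hfs (hf a)) measurable_const hs, fun x i hi => ?_⟩
      rcases Finset.mem_cons.1 hi with rfl | hi <;> simp only <;> split_ifs with h
      · exact le_rfl
      · exact (not_le.1 h).le
      · exact (hmax x i hi).trans h
      · exact hmax x i hi
  obtain ⟨s, hs, hmax⟩ := key Finset.univ Finset.univ_nonempty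
  exact ⟨s, hs, fun x i => hmax x i (Finset.mem_univ i)⟩

/-! ### Gaussian concentration of a maximum by rotation -/

section Concentration

variable {E : Type*} [NormedAddCommGroup E] [InnerProductSpace ℝ E]

/-- Testing the maximum at `X j` against the maximiser at `X (j + 1)` bounds each increment by a
term linear in `X' (j + 1)`. This replaces differentiating the maximum along the rotation, so no
smoothness is needed; the price is the factor `cos h` per step. -/
theorem cos_pow_mul_sub_le_sum_of_rotation {ι : Type*} (u : ι → E) (s : E → ι)
    (hs : ∀ x i, inner ℝ (u i) x ≤ inner ℝ (u (s x)) x) (x y : E) (h : ℝ) (hcos : 0 ≤ Real.cos h)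
    (X X' : ℕ → E) (hX : ∀ j, X j = Real.cos (j * h) • x + Real.sin (j * h) • y)
    (hX' : ∀ j, X' j = -Real.sin (j * h) • x + Real.cos (j * h) • y) (m : ℕ) :
    Real.cos h ^ m * inner ℝ (u (s (X m))) (X m) - inner ℝ (u (s (X 0))) (X 0) ≤
      ∑ j ∈ Finset.range m,
        Real.cos h ^ j * Real.sin h * inner ℝ (u (s (X (j + 1)))) (X' (j + 1)) := by
  have step : ∀ j, X j = Real.cos h • X (j + 1) - Real.sin h • X' (j + 1) := by
    intro j
    have e : (j : ℝ) * h = ((j + 1 : ℕ) : ℝ) * h - h := by push_cast; ring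
    rw [hX j, hX (j + 1), hX' (j + 1), e, Real.cos_sub, Real.sin_sub]
    module
  induction m with
  | zero => simp
  | succ m ih =>
    rw [Finset.sum_range_succ]
    have h1 := hs (X m) (s (X (m + 1)))
    conv_lhs at h1 => rw [step m, inner_sub_right, inner_smul_right, inner_smul_right]
    have h2 := mul_le_mul_of_nonneg_left h1 (pow_nonneg hcos m)
    rw [pow_succ]
    linarith

theorem exp_sum_le_average_exp (m : ℕ) (hm : 0 < m) (z : ℕ → ℝ) :
    Real.exp (∑ j ∈ Finset.range m, z j) ≤
      ∑ j ∈ Finset.range m, (m : ℝ)⁻¹ * Real.exp (m * z j) := by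
  have hm' : (m : ℝ) ≠ 0 := by positivity
  have := convexOn_exp.map_sum_le (t := Finset.range m) (w := fun _ => (m : ℝ)⁻¹)
    (p := fun j => m * z j) (fun _ _ => by positivity) (by simp [hm']) (fun _ _ => Set.mem_univ _)
  simpa only [smul_eq_mul, inv_mul_cancel_left₀ hm'] using this

variable [FiniteDimensional ℝ E] [MeasurableSpace E] [BorelSpace E]

theorem map_inner_stdGaussian (u : E) :
    (stdGaussian E).map (fun x => inner ℝ u x) = gaussianReal 0 (‖u‖₊ ^ 2) := by
  have h := IsGaussian.map_eq_gaussianReal (μ := stdGaussian E) (innerSL ℝ u)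
  rw [integral_strongDual_stdGaussian, variance_dual_stdGaussian] at h
  have h1 : (⇑(innerSL ℝ u) : E → ℝ) = fun x => inner ℝ u x := by ext; simp
  rw [h1] at h
  rw [h]
  congr 1
  ext
  simp

theorem lintegral_exp_inner_stdGaussian (u : E) (c : ℝ) :
    ∫⁻ x, ENNReal.ofReal (Real.exp (c * inner ℝ u x)) ∂(stdGaussian E) =
      ENNReal.ofReal (Real.exp (c ^ 2 * ‖u‖ ^ 2 / 2)) := by
  have hlaw := map_inner_stdGaussian u
  have h := mgf_gaussianReal (p := stdGaussian E) hlaw c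
  have hint : Integrable (fun x => Real.exp (c * inner ℝ u x)) (stdGaussian E) := by
    have := integrable_exp_mul_gaussianReal (μ := 0) (v := ‖u‖₊ ^ 2) c
    rw [← hlaw] at this
    exact this.comp_measurable (by fun_prop)
  rw [← ofReal_integral_eq_lintegral_ofReal hint (ae_of_all _ fun _ => (Real.exp_pos _).le)]
  congr 1
  rw [mgf] at h
  rw [h]
  congr 1
  simp
  ring

theorem map_rotation_stdGaussian (θ : ℝ) :
    ((stdGaussian E).prod (stdGaussian E)).map
        (fun ω : E × E => (Real.cos θ • ω.1 + Real.sin θ • ω.2,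
          -Real.sin θ • ω.1 + Real.cos θ • ω.2)) =
      (stdGaussian E).prod (stdGaussian E) := by
  have := IsGaussian.map_rotation_eq_self_of_forall_strongDual_eq_zero (μ := stdGaussian E)
    integral_strongDual_stdGaussian θ
  convert this using 2
  ext ω <;> simp [ContinuousLinearMap.rotation_apply]

/-- The rotated pair is again a pair of independent standard Gaussians, so given the first
component, which fixes the direction `u (s ·)`, the inner product with the second is standard
normal. -/
theorem lintegral_exp_inner_rotation_le {ι : Type*} [Countable ι] [MeasurableSpace ι]
    [DiscreteMeasurableSpace ι] (u : ι → E) (hu : ∀ i, ‖u i‖ = 1) (s : E → ι) (hs : Measurable s)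
    (θ c C : ℝ) (hc : 0 ≤ c) (hcC : c ≤ C) :
    ∫⁻ ω : E × E, ENNReal.ofReal (Real.exp
        (c * inner ℝ (u (s (Real.cos θ • ω.1 + Real.sin θ • ω.2)))
          (-Real.sin θ • ω.1 + Real.cos θ • ω.2)))
      ∂((stdGaussian E).prod (stdGaussian E)) ≤ ENNReal.ofReal (Real.exp (C ^ 2 / 2)) := by
  set F : E × E → ENNReal := fun ω => ENNReal.ofReal (Real.exp (c * inner ℝ (u (s ω.1)) ω.2))
  have hF : Measurable F := by
    have h1 : Measurable fun q : ι × E => inner ℝ (u q.1) q.2 :=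
      measurable_from_prod_countable_right fun i => by fun_prop
    have h2 : Measurable fun ω : E × E => inner ℝ (u (s ω.1)) ω.2 :=
      h1.comp ((hs.comp measurable_fst).prodMk measurable_snd)
    fun_prop
  calc _ = ∫⁻ ω, F ω ∂(((stdGaussian E).prod (stdGaussian E)).map
        (fun ω : E × E => (Real.cos θ • ω.1 + Real.sin θ • ω.2,
          -Real.sin θ • ω.1 + Real.cos θ • ω.2))) := by
        rw [lintegral_map hF (by fun_prop)]
    _ = ∫⁻ x, ∫⁻ y, F (x, y) ∂(stdGaussian E) ∂(stdGaussian E) := by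
        rw [map_rotation_stdGaussian, lintegral_prod _ hF.aemeasurable]
    _ = ENNReal.ofReal (Real.exp (c ^ 2 / 2)) := by
        simp only [F, lintegral_exp_inner_stdGaussian, hu]
        simp
    _ ≤ _ := by gcongr

/-- A discrete form of the Maurey–Pisier rotation argument. -/
theorem stdGaussian_max_concentration_discrete {ι : Type*} [Countable ι] [MeasurableSpace ι]
    [DiscreteMeasurableSpace ι] (u : ι → E) (hu : ∀ i, ‖u i‖ = 1) (s : E → ι) (hs : Measurable s)
    (hmax : ∀ x i, inner ℝ (u i) x ≤ inner ℝ (u (s x)) x) (a b l : ℝ) (hl : 0 ≤ l)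
    (m : ℕ) (hm : 0 < m) :
    (stdGaussian E).real {x | inner ℝ (u (s x)) x < b} *
        (stdGaussian E).real {x | a ≤ inner ℝ (u (s x)) x} *
        Real.exp (l * (Real.cos (Real.pi / 2 / m) ^ m * a - b)) ≤
      Real.exp ((l * (Real.pi / 2)) ^ 2 / 2) := by
  set γ := stdGaussian E
  set h : ℝ := Real.pi / 2 / m with hh
  have hm' : (0 : ℝ) < m := by exact_mod_cast hm
  have hm1 : (1 : ℝ) ≤ m := by exact_mod_cast hm
  have hpi := Real.pi_pos
  have hh0 : 0 ≤ h := by positivity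
  have hhle : h ≤ Real.pi / 2 := div_le_self (by positivity) hm1
  have hmh : m * h = Real.pi / 2 := by rw [hh]; field_simp
  have hcos : 0 ≤ Real.cos h := Real.cos_nonneg_of_mem_Icc ⟨by linarith, hhle⟩
  have hsin : 0 ≤ Real.sin h := Real.sin_nonneg_of_nonneg_of_le_pi hh0 (by linarith)
  have hsinle : Real.sin h ≤ h := Real.sin_le hh0
  have hM : Measurable fun x => inner ℝ (u (s x)) x := by
    have h1 : Measurable fun q : ι × E => inner ℝ (u q.1) q.2 :=
      measurable_from_prod_countable_right fun i => by fun_prop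
    exact h1.comp (hs.prodMk measurable_id)
  set G : ℕ → E × E → ENNReal := fun j ω => ENNReal.ofReal (Real.exp
        ((m * (l * (Real.cos h ^ j * Real.sin h))) *
          inner ℝ (u (s (Real.cos ((j + 1 : ℕ) * h) • ω.1 + Real.sin ((j + 1 : ℕ) * h) • ω.2)))
          (-Real.sin ((j + 1 : ℕ) * h) • ω.1 + Real.cos ((j + 1 : ℕ) * h) • ω.2))) with hG
  have hGm : ∀ j, Measurable (G j) := by
    intro j
    have h1 : Measurable fun q : ι × E => inner ℝ (u q.1) q.2 :=
      measurable_from_prod_countable_right fun i => by fun_prop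
    have h2 : Measurable fun ω : E × E =>
      inner ℝ (u (s (Real.cos ((j + 1 : ℕ) * h) • ω.1 + Real.sin ((j + 1 : ℕ) * h) • ω.2)))
          (-Real.sin ((j + 1 : ℕ) * h) • ω.1 + Real.cos ((j + 1 : ℕ) * h) • ω.2) :=
      h1.comp ((hs.comp (by fun_prop)).prodMk (by fun_prop))
    simp only [hG]
    fun_prop
  have hGint : ∀ j, ∫⁻ ω, G j ω ∂(γ.prod γ) ≤
      ENNReal.ofReal (Real.exp ((l * (Real.pi / 2)) ^ 2 / 2)) := by
    intro j
    refine lintegral_exp_inner_rotation_le u hu s hs _ _ _ (by positivity) ?_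
    -- The factor `m` produced by Jensen is absorbed by the step size: `m * sin h ≤ m * h = π/2`.
    have : Real.cos h ^ j * Real.sin h ≤ h := by
      calc _ ≤ 1 * h := by
            gcongr
            exact pow_le_one₀ hcos (Real.cos_le_one h)
        _ = h := one_mul h
    calc (m : ℝ) * (l * (Real.cos h ^ j * Real.sin h)) ≤ m * (l * h) := by gcongr
      _ = l * (m * h) := by ring
      _ = _ := by rw [hmh]
  set S : Set (E × E) := {x | inner ℝ (u (s x)) x < b} ×ˢ {x | a ≤ inner ℝ (u (s x)) x} with hS
  have hSm : MeasurableSet S :=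
    (measurableSet_lt hM measurable_const).prod (measurableSet_le measurable_const hM)
  set e := Real.exp (l * (Real.cos h ^ m * a - b))
  have hpoint : ∀ ω ∈ S, ENNReal.ofReal e ≤
      ∑ j ∈ Finset.range m, ENNReal.ofReal ((m : ℝ)⁻¹) * G j ω := by
    intro ω hω
    have hω1 : inner ℝ (u (s ω.1)) ω.1 < b := hω.1
    have hω2 : a ≤ inner ℝ (u (s ω.2)) ω.2 := hω.2
    have key := cos_pow_mul_sub_le_sum_of_rotation u s hmax ω.1 ω.2 h hcos
      (fun j => Real.cos (j * h) • ω.1 + Real.sin (j * h) • ω.2)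
      (fun j => -Real.sin (j * h) • ω.1 + Real.cos (j * h) • ω.2) (fun _ => rfl) (fun _ => rfl) m
    have e0 : Real.cos ((0 : ℕ) * h) • ω.1 + Real.sin ((0 : ℕ) * h) • ω.2 = ω.1 := by simp
    have e1 : Real.cos ((m : ℕ) * h) • ω.1 + Real.sin ((m : ℕ) * h) • ω.2 = ω.2 := by
      rw [hmh]; simp
    simp only [e0, e1] at key
    have h3 : Real.cos h ^ m * a ≤ Real.cos h ^ m * inner ℝ (u (s ω.2)) ω.2 := by gcongr
    have h4 : l * (Real.cos h ^ m * a - b) ≤ l * _ :=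
      mul_le_mul_of_nonneg_left (le_trans (by linarith) key) hl
    rw [Finset.mul_sum] at h4
    have h5 := (Real.exp_le_exp.2 h4).trans (exp_sum_le_average_exp m hm _)
    refine (ENNReal.ofReal_le_ofReal h5).trans (le_of_eq ?_)
    rw [ENNReal.ofReal_sum_of_nonneg (fun _ _ => by positivity)]
    refine Finset.sum_congr rfl fun j _ => ?_
    rw [ENNReal.ofReal_mul (by positivity)]
    congr 3
    ring
  have hmain : (γ.prod γ) S * ENNReal.ofReal e ≤
      ENNReal.ofReal (Real.exp ((l * (Real.pi / 2)) ^ 2 / 2)) := by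
    calc (γ.prod γ) S * ENNReal.ofReal e = ∫⁻ _ in S, ENNReal.ofReal e ∂(γ.prod γ) := by
          rw [setLIntegral_const, mul_comm]
      _ ≤ ∫⁻ ω in S, ∑ j ∈ Finset.range m, ENNReal.ofReal ((m : ℝ)⁻¹) * G j ω ∂(γ.prod γ) :=
          setLIntegral_mono' hSm hpoint
      _ ≤ ∫⁻ ω, ∑ j ∈ Finset.range m, ENNReal.ofReal ((m : ℝ)⁻¹) * G j ω ∂(γ.prod γ) :=
          setLIntegral_le_lintegral _ _
      _ = ∑ j ∈ Finset.range m, ENNReal.ofReal ((m : ℝ)⁻¹) * ∫⁻ ω, G j ω ∂(γ.prod γ) := by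
          rw [lintegral_finsetSum _ (fun j _ => (hGm j).const_mul _)]
          refine Finset.sum_congr rfl fun j _ => lintegral_const_mul _ (hGm j)
      _ ≤ ∑ j ∈ Finset.range m, ENNReal.ofReal ((m : ℝ)⁻¹) *
            ENNReal.ofReal (Real.exp ((l * (Real.pi / 2)) ^ 2 / 2)) := by
          gcongr with j _
          exact hGint j
      _ = _ := by
          rw [Finset.sum_const, Finset.card_range, nsmul_eq_mul, ← mul_assoc,
            ← ENNReal.ofReal_natCast, ← ENNReal.ofReal_mul hm'.le, mul_inv_cancel₀ hm'.ne']
          simp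
  rw [hS, Measure.prod_prod] at hmain
  have := ENNReal.toReal_mono ENNReal.ofReal_ne_top hmain
  rwa [ENNReal.toReal_mul, ENNReal.toReal_mul, ENNReal.toReal_ofReal (Real.exp_pos _).le,
    ENNReal.toReal_ofReal (Real.exp_pos _).le] at this

/-- By Bernoulli, the `m`-th power is at least `1 - t²/(2m)`, so the discretization loss vanishes in
the limit. -/
theorem tendsto_cos_div_pow_self (t : ℝ) :
    Tendsto (fun m : ℕ => Real.cos (t / m) ^ m) atTop (𝓝 1) := by
  have hlow : Tendsto (fun m : ℕ => 1 - t ^ 2 / 2 / m) atTop (𝓝 1) := by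
    simpa using (tendsto_const_nhds (x := (1 : ℝ))).sub
      (tendsto_const_div_atTop_nhds_zero_nat (t ^ 2 / 2))
  have hsmall : ∀ᶠ m : ℕ in atTop, |t / m| ≤ 1 := by
    have h1 := (tendsto_const_div_atTop_nhds_zero_nat t).abs
    rw [abs_zero] at h1
    exact h1.eventually_le_const one_pos
  refine tendsto_of_tendsto_of_tendsto_of_le_of_le' hlow tendsto_const_nhds ?_ ?_
  · filter_upwards [hsmall, eventually_gt_atTop 0] with m hm hm0
    have hm' : (0 : ℝ) < m := by exact_mod_cast hm0
    have h1 : 1 - (t / m) ^ 2 / 2 ≤ Real.cos (t / m) := Real.one_sub_sq_div_two_le_cos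
    have h2 : (t / m) ^ 2 ≤ 1 := by rw [sq_le_one_iff_abs_le_one]; exact hm
    have h3 := one_add_mul_le_pow (a := -((t / m) ^ 2 / 2)) (by linarith) m
    calc 1 - t ^ 2 / 2 / m = 1 + m * -((t / m) ^ 2 / 2) := by field_simp; ring
      _ ≤ (1 + -((t / m) ^ 2 / 2)) ^ m := h3
      _ ≤ _ := by
          apply pow_le_pow_left₀ <;> linarith
  · filter_upwards [hsmall] with m hm
    have : |t / m| ≤ Real.pi / 2 := hm.trans (by linarith [Real.pi_gt_three])
    rw [abs_le] at this
    exact pow_le_one₀ (Real.cos_nonneg_of_mem_Icc ⟨by linarith, this.2⟩) (Real.cos_le_one _)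

theorem stdGaussian_max_concentration {ι : Type*} [Countable ι] [MeasurableSpace ι]
    [DiscreteMeasurableSpace ι] (u : ι → E) (hu : ∀ i, ‖u i‖ = 1) (s : E → ι) (hs : Measurable s)
    (hmax : ∀ x i, inner ℝ (u i) x ≤ inner ℝ (u (s x)) x) (a b l : ℝ) (hl : 0 ≤ l) :
    (stdGaussian E).real {x | inner ℝ (u (s x)) x < b} *
        (stdGaussian E).real {x | a ≤ inner ℝ (u (s x)) x} * Real.exp (l * (a - b)) ≤
      Real.exp ((l * (Real.pi / 2)) ^ 2 / 2) := by
  have hlim : Tendsto (fun m : ℕ => (stdGaussian E).real {x | inner ℝ (u (s x)) x < b} *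
        (stdGaussian E).real {x | a ≤ inner ℝ (u (s x)) x} *
        Real.exp (l * (Real.cos (Real.pi / 2 / m) ^ m * a - b))) atTop
      (𝓝 ((stdGaussian E).real {x | inner ℝ (u (s x)) x < b} *
        (stdGaussian E).real {x | a ≤ inner ℝ (u (s x)) x} * Real.exp (l * (1 * a - b)))) :=
    ((Real.continuous_exp.tendsto _).comp
      ((((tendsto_cos_div_pow_self _).mul_const a).sub_const b).const_mul l)).const_mul _
  rw [one_mul] at hlim
  refine le_of_tendsto hlim ?_
  filter_upwards [eventually_gt_atTop 0] with m hm
  exact stdGaussian_max_concentration_discrete u hu s hs hmax a b l hl m hm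

end Concentration

/-! ### Second moment method and Gaussian tails -/

theorem sq_sum_measureReal_le {Ω ι : Type*} [MeasurableSpace Ω] [Fintype ι] (μ : Measure Ω)
    [IsFiniteMeasure μ] (S : ι → Set Ω) (hS : ∀ i, MeasurableSet (S i)) :
    (∑ i, μ.real (S i)) ^ 2 ≤ μ.real (⋃ i, S i) * ∑ i, ∑ j, μ.real (S i ∩ S j) := by
  classical
  have hU : MeasurableSet (⋃ i, S i) := MeasurableSet.iUnion hS
  have hint : ∀ A : Set Ω, MeasurableSet A → Integrable (A.indicator (1 : Ω → ℝ)) μ :=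
    fun A hA => (integrable_const (1 : ℝ)).indicator hA
  have hval : ∀ A : Set Ω, MeasurableSet A → ∫ x, A.indicator (1 : Ω → ℝ) x ∂μ = μ.real A :=
    fun A hA => integral_indicator_one hA
  -- Cauchy–Schwarz through the discriminant: with `X = ∑ 1_{S i}` and `U = ⋃ S i`, the quadratic is
  -- `∫ (X - r 1_U)²`, because `X` vanishes off `U`.
  have key : ∀ r : ℝ, 0 ≤ μ.real (⋃ i, S i) * (r * r) + (-2 * ∑ i, μ.real (S i)) * r +
      ∑ i, ∑ j, μ.real (S i ∩ S j) := by
    intro r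
    have h1 : ∫ x, ((⋃ i, S i).indicator (1 : Ω → ℝ) x * (r * r) +
        (-2 * ∑ i, (S i).indicator (1 : Ω → ℝ) x) * r +
        ∑ i, ∑ j, (S i ∩ S j).indicator (1 : Ω → ℝ) x) ∂μ =
        μ.real (⋃ i, S i) * (r * r) + (-2 * ∑ i, μ.real (S i)) * r +
          ∑ i, ∑ j, μ.real (S i ∩ S j) := by
      have i1 := (hint _ hU).mul_const (r * r)
      have i2' : Integrable (fun x => ∑ i, (S i).indicator (1 : Ω → ℝ) x) μ :=
        integrable_finsetSum _ fun i _ => hint _ (hS i)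
      have i2 := (i2'.const_mul (-2)).mul_const r
      have i3 : Integrable (fun x => ∑ i, ∑ j, (S i ∩ S j).indicator (1 : Ω → ℝ) x) μ :=
        integrable_finsetSum _ fun i _ => integrable_finsetSum _ fun j _ =>
          hint _ ((hS i).inter (hS j))
      rw [integral_add (by exact i1.add i2) i3, integral_add i1 i2, integral_mul_const, integral_mul_const,
        integral_const_mul, hval _ hU, integral_finsetSum _ fun i _ => hint _ (hS i),
        integral_finsetSum _ fun i _ => integrable_finsetSum _ fun j _ =>
          hint _ ((hS i).inter (hS j))]
      congr 1
      · simp_rw [hval _ (hS _)]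
      · refine Finset.sum_congr rfl fun i _ => ?_
        rw [integral_finsetSum _ fun j _ => hint _ ((hS i).inter (hS j))]
        exact Finset.sum_congr rfl fun j _ => hval _ ((hS i).inter (hS j))
    rw [← h1]
    refine integral_nonneg fun x => ?_
    set X : ℝ := ∑ i, (S i).indicator (1 : Ω → ℝ) x with hX
    have h2 : ∑ i, ∑ j, (S i ∩ S j).indicator (1 : Ω → ℝ) x = X * X := by
      simp_rw [hX, Finset.sum_mul_sum, Set.inter_indicator_one, Pi.mul_apply]
    change 0 ≤ _
    simp only []
    rw [h2]
    by_cases hx : x ∈ ⋃ i, S i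
    · rw [Set.indicator_of_mem hx, Pi.one_apply]
      nlinarith [sq_nonneg (X - r)]
    · have : X = 0 := Finset.sum_eq_zero fun i _ =>
        Set.indicator_of_notMem (fun h => hx (Set.mem_iUnion.2 ⟨i, h⟩)) _
      rw [this, Set.indicator_of_notMem hx]
      simp
  have := discrim_le_zero key
  rw [discrim] at this
  nlinarith

theorem gaussianReal_real_eq_integral (s : Set ℝ) :
    (gaussianReal 0 1).real s = ∫ x in s, gaussianPDFReal 0 1 x := by
  rw [measureReal_def, gaussianReal_apply_eq_integral 0 one_ne_zero, ENNReal.toReal_ofReal]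
  exact integral_nonneg fun x => gaussianPDFReal_nonneg _ _ _

theorem gaussianPDFReal_zero_one (x : ℝ) :
    gaussianPDFReal 0 1 x = (√(2 * Real.pi))⁻¹ * Real.exp (-x ^ 2 / 2) := by
  simp [gaussianPDFReal]

/-- Bounds the density from below on `[t, t + 1]` only. The loss is `exp (O(t))`, harmless against
the later gain, which is quadratic in the exponent. -/
theorem le_gaussianReal_Ici (t : ℝ) (ht : 0 ≤ t) :
    (√(2 * Real.pi))⁻¹ * Real.exp (-(t + 1) ^ 2 / 2) ≤ (gaussianReal 0 1).real (Set.Ici t) := by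
  rw [gaussianReal_real_eq_integral]
  have h1 : ∫ _ in Set.Icc t (t + 1), (√(2 * Real.pi))⁻¹ * Real.exp (-(t + 1) ^ 2 / 2) ≤
      ∫ x in Set.Icc t (t + 1), gaussianPDFReal 0 1 x := by
    refine setIntegral_mono_on (integrableOn_const (by simp)) (integrable_gaussianPDFReal 0 1).integrableOn
      measurableSet_Icc fun x hx => ?_
    rw [gaussianPDFReal_zero_one]
    gcongr
    · exact ht.trans hx.1
    · exact hx.2
  have h2 : ∫ x in Set.Icc t (t + 1), gaussianPDFReal 0 1 x ≤
      ∫ x in Set.Ici t, gaussianPDFReal 0 1 x :=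
    setIntegral_mono_set (integrable_gaussianPDFReal 0 1).integrableOn
      (ae_of_all _ fun x => gaussianPDFReal_nonneg _ _ _)
      (Set.Icc_subset_Ici_self.eventuallyLE)
  refine le_trans (le_of_eq ?_) (h1.trans h2)
  simp

/-- On the tail `1 ≤ x / t`, which makes the integrand exact. The factor `1 / t` must be kept: it is
all that survives the union bound. -/
theorem gaussianReal_Ioi_le (t : ℝ) (ht : 0 < t) :
    (gaussianReal 0 1).real (Set.Ioi t) ≤ Real.exp (-t ^ 2 / 2) / t := by
  rw [gaussianReal_real_eq_integral]
  have hderiv : ∀ x ∈ Set.Ici t,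
      HasDerivAt (fun x => -(Real.exp (-x ^ 2 / 2) / t)) (x / t * Real.exp (-x ^ 2 / 2)) x := by
    intro x _
    have h1 : HasDerivAt (fun x : ℝ => -x ^ 2 / 2) (-x) x := by
      have := ((hasDerivAt_pow 2 x).neg).div_const 2
      exact this.congr_deriv (by push_cast; ring)
    have := (h1.exp.div_const t).neg
    exact this.congr_deriv (by ring)
  have hint : IntegrableOn (fun x => x / t * Real.exp (-x ^ 2 / 2)) (Set.Ioi t) := by
    have := (integrable_mul_exp_neg_mul_sq (b := 1 / 2) (by norm_num)).const_mul t⁻¹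
    refine (this.congr (ae_of_all _ fun x => ?_)).integrableOn
    have : -(1 / 2) * x ^ 2 = -x ^ 2 / 2 := by ring
    simp only [this]
    ring
  have hlim : Tendsto (fun x : ℝ => -(Real.exp (-x ^ 2 / 2) / t)) atTop (𝓝 0) := by
    have h1 : Tendsto (fun x : ℝ => -x ^ 2 / 2) atTop atBot := by
      have : Tendsto (fun x : ℝ => x ^ 2 / 2) atTop atTop :=
        (tendsto_pow_atTop two_ne_zero).atTop_div_const two_pos
      refine (tendsto_neg_atTop_atBot.comp this).congr fun x => ?_
      simp only [Function.comp]
      ring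
    simpa using ((Real.tendsto_exp_atBot.comp h1).div_const t).neg
  have hval := integral_Ioi_of_hasDerivAt_of_tendsto' hderiv hint hlim
  have hs : (1 : ℝ) ≤ √(2 * Real.pi) := by
    rw [Real.one_le_sqrt]
    linarith [Real.pi_gt_three]
  calc ∫ x in Set.Ioi t, gaussianPDFReal 0 1 x
      ≤ ∫ x in Set.Ioi t, x / t * Real.exp (-x ^ 2 / 2) := by
        refine setIntegral_mono_on (integrable_gaussianPDFReal 0 1).integrableOn hint
          measurableSet_Ioi fun x hx => ?_
        rw [gaussianPDFReal_zero_one]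
        gcongr
        exact (inv_le_one_of_one_le₀ hs).trans ((one_le_div ht).2 (le_of_lt hx))
    _ = _ := by rw [hval]; ring

section SecondMoment

variable {E : Type*} [NormedAddCommGroup E] [InnerProductSpace ℝ E] [FiniteDimensional ℝ E]
  [MeasurableSpace E] [BorelSpace E]

theorem stdGaussian_real_inner_mem (u : E) (hu : ‖u‖ = 1) (s : Set ℝ) (hs : MeasurableSet s) :
    (stdGaussian E).real {x | inner ℝ u x ∈ s} = (gaussianReal 0 1).real s := by
  have h := map_inner_stdGaussian u
  have hu' : ‖u‖₊ = 1 := by ext; simpa using hu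
  rw [hu', one_pow] at h
  rw [← h, map_measureReal_apply (by fun_prop) hs]
  rfl

/-- Chernoff bound for the inner product with `u + v`, whose variance is `2 (1 + ⟨u, v⟩)`. -/
theorem stdGaussian_real_le_inner_and_le_inner_le (u v : E) (hu : ‖u‖ = 1) (hv : ‖v‖ = 1)
    (t c : ℝ) (hc : 0 ≤ c) :
    (stdGaussian E).real {x | t ≤ inner ℝ u x ∧ t ≤ inner ℝ v x} ≤
      Real.exp (-2 * c * t + c ^ 2 * (1 + inner ℝ u v)) := by
  have hm := lintegral_exp_inner_stdGaussian (u + v) c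
  have hn : ‖u + v‖ ^ 2 = 2 * (1 + inner ℝ u v) := by
    rw [norm_add_sq_real, hu, hv]; ring
  rw [hn] at hm
  have hmeas : Measurable fun x : E =>
      ENNReal.ofReal (Real.exp (c * inner ℝ (u + v) x)) := by fun_prop
  have h1 := mul_meas_ge_le_lintegral (μ := stdGaussian E) hmeas
    (ENNReal.ofReal (Real.exp (2 * c * t)))
  rw [hm] at h1
  have hsub : {x : E | t ≤ inner ℝ u x ∧ t ≤ inner ℝ v x} ⊆
      {x | ENNReal.ofReal (Real.exp (2 * c * t)) ≤
        ENNReal.ofReal (Real.exp (c * inner ℝ (u + v) x))} := by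
    rintro x ⟨h1, h2⟩
    refine ENNReal.ofReal_le_ofReal (Real.exp_le_exp.2 ?_)
    rw [inner_add_left]
    nlinarith
  have h2 := (mul_le_mul_right (measure_mono hsub) _).trans h1
  have h3 := ENNReal.toReal_mono ENNReal.ofReal_ne_top h2
  rw [ENNReal.toReal_mul, ENNReal.toReal_ofReal (Real.exp_pos _).le,
    ENNReal.toReal_ofReal (Real.exp_pos _).le] at h3
  have h4 : -2 * c * t + c ^ 2 * (1 + inner ℝ u v) =
    c ^ 2 * (2 * (1 + inner ℝ u v)) / 2 - 2 * c * t := by ring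
  rw [h4, Real.exp_sub, le_div_iff₀ (Real.exp_pos _), mul_comm]
  exact h3

/-- Second moment bound: few pairs of directions have correlation above `η`. -/
theorem one_le_stdGaussian_real_exists_le_inner_mul {ι : Type*} [Fintype ι] [Nonempty ι]
    (u : ι → E) (hu : ∀ i, ‖u i‖ = 1) (η t B : ℝ) (ht : 0 ≤ t)
    (hB : ∀ i, ({j | η < inner ℝ (u i) (u j)} : Set ι).ncard ≤ B) :
    1 ≤ (stdGaussian E).real {x | ∃ i, t ≤ inner ℝ (u i) x} *
      (2 * Real.pi * Real.exp (2 * t + 1) *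
        (Real.exp (η * t ^ 2) + B / Fintype.card ι * Real.exp (t ^ 2 / 2))) := by
  classical
  set L : ℝ := (Fintype.card ι : ℝ) with hLdef
  have hL : 0 < L := by simp [L, Fintype.card_pos]
  set S : ι → Set E := fun i => {x | t ≤ inner ℝ (u i) x} with hSdef
  have hS : ∀ i, MeasurableSet (S i) := fun i => measurableSet_le measurable_const (by fun_prop)
  set P := (stdGaussian E).real {x | ∃ i, t ≤ inner ℝ (u i) x} with hPdef
  have hU : (⋃ i, S i) = {x | ∃ i, t ≤ inner ℝ (u i) x} := by ext; simp [S]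
  have hsm := sq_sum_measureReal_le (stdGaussian E) S hS
  rw [hU] at hsm
  have hfirst : L * ((√(2 * Real.pi))⁻¹ * Real.exp (-(t + 1) ^ 2 / 2)) ≤
      ∑ i, (stdGaussian E).real (S i) := by
    rw [hLdef, ← nsmul_eq_mul, ← Finset.card_univ, ← Finset.sum_const]
    refine Finset.sum_le_sum fun i _ => ?_
    exact (le_gaussianReal_Ici t ht).trans_eq
      (stdGaussian_real_inner_mem (u i) (hu i) _ measurableSet_Ici).symm
  have hpair : ∀ i, ∑ j, (stdGaussian E).real (S i ∩ S j) ≤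
      L * Real.exp (-t ^ 2 + η * t ^ 2) + B * Real.exp (-t ^ 2 / 2) := by
    intro i
    have hj : ∀ j, (stdGaussian E).real (S i ∩ S j) ≤ Real.exp (-t ^ 2 + η * t ^ 2) +
        (if η < inner ℝ (u i) (u j) then Real.exp (-t ^ 2 / 2) else 0) := by
      intro j
      split_ifs with h
      -- For a strongly correlated pair the second event is dropped; taking `v = u` and `c = t / 2`
      -- gives the one-variable bound `exp (-t²/2)`.
      · have h1 := stdGaussian_real_le_inner_and_le_inner_le (u i) (u i) (hu i) (hu i) t (t / 2)
          (by positivity)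
        rw [real_inner_self_eq_norm_sq, hu i] at h1
        have h2 : (stdGaussian E).real (S i ∩ S j) ≤
            (stdGaussian E).real {x | t ≤ inner ℝ (u i) x ∧ t ≤ inner ℝ (u i) x} :=
          measureReal_mono (fun x hx => ⟨hx.1, hx.1⟩)
        have h3 : -2 * (t / 2) * t + (t / 2) ^ 2 * (1 + 1 ^ 2) = -t ^ 2 / 2 := by ring
        rw [h3] at h1
        linarith [Real.exp_pos (-t ^ 2 + η * t ^ 2)]
      · rw [add_zero]
        refine (stdGaussian_real_le_inner_and_le_inner_le (u i) (u j) (hu i) (hu j) t t ht).trans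
          (Real.exp_le_exp.2 ?_)
        nlinarith [sq_nonneg t, not_lt.1 h]
    refine (Finset.sum_le_sum fun j _ => hj j).trans ?_
    rw [Finset.sum_add_distrib, Finset.sum_const, Finset.card_univ, nsmul_eq_mul,
      ← Finset.sum_filter, Finset.sum_const, nsmul_eq_mul]
    have h4 := hB i
    rw [Set.ncard_eq_toFinset_card', Set.toFinset_ofPred] at h4
    gcongr
  have hsecond : ∑ i, ∑ j, (stdGaussian E).real (S i ∩ S j) ≤
      L * (L * Real.exp (-t ^ 2 + η * t ^ 2) + B * Real.exp (-t ^ 2 / 2)) := by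
    conv_rhs => rw [hLdef, ← nsmul_eq_mul, ← Finset.card_univ, ← Finset.sum_const]
    exact Finset.sum_le_sum fun i _ => hpair i
  have hP : 0 ≤ P := measureReal_nonneg
  have hall := (pow_le_pow_left₀ (by positivity) hfirst 2).trans
    (hsm.trans (mul_le_mul_of_nonneg_left hsecond hP))
  have e1 : (L * ((√(2 * Real.pi))⁻¹ * Real.exp (-(t + 1) ^ 2 / 2))) ^ 2 =
      L ^ 2 * Real.exp (-t ^ 2) / (2 * Real.pi * Real.exp (2 * t + 1)) := by
    rw [mul_pow, mul_pow, inv_pow, Real.sq_sqrt (by positivity), ← Real.exp_nat_mul]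
    have : ((2 : ℕ) : ℝ) * (-(t + 1) ^ 2 / 2) = -t ^ 2 - (2 * t + 1) := by push_cast; ring
    rw [this, Real.exp_sub]
    field_simp
  have e2 : L * (L * Real.exp (-t ^ 2 + η * t ^ 2) + B * Real.exp (-t ^ 2 / 2)) =
      L ^ 2 * Real.exp (-t ^ 2) * (Real.exp (η * t ^ 2) + B / L * Real.exp (t ^ 2 / 2)) := by
    have : -t ^ 2 / 2 = -t ^ 2 + t ^ 2 / 2 := by ring
    rw [this, Real.exp_add, Real.exp_add]
    field_simp
  rw [e1, e2, div_le_iff₀ (by positivity)] at hall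
  refine le_of_mul_le_mul_left ?_ (show 0 < L ^ 2 * Real.exp (-t ^ 2) by positivity)
  rw [mul_one]
  refine hall.trans_eq ?_
  ring

end SecondMoment

/-! ### Counting index sets with large overlap -/

theorem card_filter_card_le_le_exp {α : Type*} [Fintype α] (r y : ℝ) (hy0 : 0 < y) (hy1 : y ≤ 1) :
    ((Finset.univ.filter fun S : Finset α => (S.card : ℝ) ≤ r).card : ℝ) ≤
      Real.exp (y * Fintype.card α - r * Real.log y) := by
  have h1 : ((Finset.univ.filter fun S : Finset α => (S.card : ℝ) ≤ r).card : ℝ) * y ^ r ≤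
      (y + 1) ^ Fintype.card α := by
    rw [← Fintype.sum_pow_mul_eq_add_pow, ← nsmul_eq_mul, ← Finset.sum_const]
    simp only [one_pow, mul_one]
    refine (Finset.sum_le_sum fun S hS => ?_).trans
      (Finset.sum_le_sum_of_subset_of_nonneg (Finset.filter_subset _ _)
        fun _ _ _ => by positivity)
    rw [← Real.rpow_natCast]
    exact Real.rpow_le_rpow_of_exponent_ge hy0 hy1 (Finset.mem_filter.1 hS).2
  have h2 : (y + 1) ^ Fintype.card α ≤ Real.exp (y * Fintype.card α) := by
    rw [mul_comm, Real.exp_nat_mul]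
    exact pow_le_pow_left₀ (by positivity) (Real.add_one_le_exp y) _
  have h3 : y ^ r = Real.exp (r * Real.log y) := by
    rw [Real.rpow_def_of_pos hy0, mul_comm]
  rw [Real.exp_sub, le_div_iff₀ (Real.exp_pos _), ← h3]
  exact h1.trans h2

/-- `J` is recovered from `I \ J` and `J \ I`, both of size less than `κ k`. -/
theorem card_filter_lt_card_inter_le_sq {α : Type*} [Fintype α] [DecidableEq α] (k : ℕ) (κ : ℝ)
    (I : Finset α) (hI : I.card = k) :
    (Finset.univ.filter fun J : {J : Finset α // J.card = k} =>
        (1 - κ) * k < ((I ∩ J.1).card : ℝ)).card ≤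
      (Finset.univ.filter fun S : Finset α => (S.card : ℝ) ≤ κ * k).card ^ 2 := by
  rw [sq, ← Finset.card_product]
  refine Finset.card_le_card_of_injOn (fun J => (I \ J.1, J.1 \ I)) ?_ ?_
  · intro J hJ
    have hJ' := (Finset.mem_filter.1 hJ).2
    have h1 : ((I \ J.1).card : ℝ) + ((I ∩ J.1).card : ℝ) = k := by
      have := Finset.card_sdiff_add_card_inter I J.1
      rw [hI] at this
      exact_mod_cast this
    have h2 : ((J.1 \ I).card : ℝ) + ((I ∩ J.1).card : ℝ) = k := by
      rw [Finset.inter_comm]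
      have := Finset.card_sdiff_add_card_inter J.1 I
      rw [J.2] at this
      exact_mod_cast this
    simp only [Finset.coe_product, Set.mem_prod, Finset.coe_filter, Finset.mem_univ, true_and,
      Set.mem_ofPred_eq]
    constructor <;> linarith
  · intro J _ J' _ h
    simp only [Prod.mk.injEq] at h
    have key : ∀ K : Finset α, K = (I \ (I \ K)) ∪ (K \ I) := by
      intro K
      ext a
      simp only [Finset.mem_union, Finset.mem_sdiff]
      tauto
    apply Subtype.ext
    rw [key J.1, key J'.1, h.1, h.2]

theorem mul_log_div_le_log_choose (k N : ℕ) (hk : 1 ≤ k) (hkN : k ≤ N) :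
    (k : ℝ) * Real.log (N / k) ≤ Real.log (N.choose k) := by
  have key : ∀ k N : ℕ, k ≤ N → ((N : ℝ) / k) ^ k ≤ N.choose k := by
    intro k
    induction k with
    | zero => intro N _; simp
    | succ k ih =>
      intro N hN
      obtain ⟨N, rfl⟩ : ∃ M, N = M + 1 := ⟨N - 1, by omega⟩
      have hN' : k ≤ N := by omega
      have h1 : (((N + 1 : ℕ) : ℝ) / ((k + 1 : ℕ) : ℝ)) ^ k ≤ ((N : ℝ) / k) ^ k := by
        rcases Nat.eq_zero_or_pos k with rfl | hk
        · simp
        · have hk' : (0 : ℝ) < k := by exact_mod_cast hk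
          have hNk : (k : ℝ) ≤ N := by exact_mod_cast hN'
          refine pow_le_pow_left₀ (by positivity) ?_ k
          rw [div_le_div_iff₀ (by positivity) hk']
          push_cast
          linarith
      have h2 : (((N + 1).choose (k + 1) : ℕ) : ℝ) = ((N + 1 : ℕ) : ℝ) / ((k + 1 : ℕ) : ℝ) *
          (N.choose k : ℝ) := by
        have := Nat.add_one_mul_choose_eq N k
        have h3 : ((k + 1 : ℕ) : ℝ) ≠ 0 := by positivity
        rw [div_mul_eq_mul_div, eq_div_iff h3]
        exact_mod_cast this.symm
      rw [h2, pow_succ, mul_comm]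
      gcongr
      exact h1.trans (ih N hN')
  have hk' : (0 : ℝ) < k := by exact_mod_cast hk
  have hN' : (0 : ℝ) < N := by exact_mod_cast hk.trans hkN
  rw [← Real.log_pow]
  exact Real.log_le_log (by positivity) (key k N hkN)

theorem exists_card_filter_lt_card_inter_le_exp (δ q : ℝ) (hδ : 0 < δ) (hq0 : 0 < q)
    (hq1 : q < 1) :
    ∃ κ : ℝ, 0 < κ ∧ κ < 1 ∧ ∀ N k : ℕ, 1 ≤ k → (k : ℝ) ≤ q * N →
      ∀ I : Finset (Fin N), I.card = k →
        ((Finset.univ.filter fun J : {J : Finset (Fin N) // J.card = k} =>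
          (1 - κ) * k < ((I ∩ J.1).card : ℝ)).card : ℝ) ≤
            Real.exp (δ * Real.log (N.choose k)) := by
  set l := -Real.log q with hl
  have hlpos : 0 < l := by have := Real.log_neg hq0 hq1; linarith
  -- This expression vanishes at `κ = 0`. Making it less than `δ` gives `2κ(1 - log κ + X) ≤ δX` for
  -- all `X ≥ l`, where `X = log (N / k)` stays above `l > 0` because `k ≤ q N` with `q < 1`.
  have hcont : Continuous fun κ : ℝ => 2 * (κ + Real.negMulLog κ) / l + 2 * κ := by
    have := Real.continuous_negMulLog
    fun_prop
  have h0 : ∀ᶠ κ in 𝓝[>] (0 : ℝ), 2 * (κ + Real.negMulLog κ) / l + 2 * κ < δ := by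
    refine nhdsWithin_le_nhds ((hcont.tendsto 0).eventually_lt_const ?_)
    simpa using hδ
  obtain ⟨κ, hκ, hκ0, hκ1⟩ := (h0.and (Ioo_mem_nhdsGT (zero_lt_one' ℝ))).exists
  refine ⟨κ, hκ0, hκ1, fun N k hk hkN I hI => ?_⟩
  have hk' : (0 : ℝ) < k := by exact_mod_cast hk
  have hN' : (0 : ℝ) < N := by
    by_contra h
    nlinarith
  have hkN' : (k : ℝ) ≤ N := hkN.trans (by nlinarith)
  set X := Real.log (N / k) with hX
  have hlX : l ≤ X := by
    rw [hl, hX, ← Real.log_inv]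
    refine Real.log_le_log (by positivity) ?_
    rw [inv_le_comm₀ hq0 (by positivity), inv_div, div_le_iff₀ hN']
    exact hkN
  have h1 := mul_log_div_le_log_choose k N hk (by exact_mod_cast hkN')
  have h2 : ((Finset.univ.filter fun S : Finset (Fin N) => (S.card : ℝ) ≤ κ * k).card : ℝ) ≤
      Real.exp (κ * k * (1 - Real.log κ + X)) := by
    -- `y = κ k / N` is the minimiser of the exponent `y N - κ k log y`.
    refine (card_filter_card_le_le_exp (κ * k) (κ * (k / N)) (by positivity) ?_).trans_eq ?_
    · exact mul_le_one₀ hκ1.le (by positivity) ((div_le_one hN').2 hkN')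
    · rw [Fintype.card_fin, Real.log_mul hκ0.ne' (by positivity)]
      have : Real.log ((k : ℝ) / N) = -X := by rw [hX, ← Real.log_inv, inv_div]
      rw [this]
      congr 1
      field_simp
      ring
  have h3 : 2 * (κ * (1 - Real.log κ + X)) ≤ δ * X := by
    have e : κ + Real.negMulLog κ = κ * (1 - Real.log κ) := by rw [Real.negMulLog]; ring
    rw [e] at hκ
    have hpos : 0 ≤ 2 * (κ * (1 - Real.log κ)) := by
      have := Real.log_neg hκ0 hκ1
      have : 0 ≤ 1 - Real.log κ := by linarith
      positivity
    have h4 : 2 * (κ * (1 - Real.log κ)) ≤ 2 * (κ * (1 - Real.log κ)) / l * X := by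
      rw [div_mul_eq_mul_div, le_div_iff₀ hlpos]
      exact mul_le_mul_of_nonneg_left hlX hpos
    nlinarith [mul_le_mul_of_nonneg_right hκ.le (hlpos.le.trans hlX)]
  calc _ ≤ (((Finset.univ.filter fun S : Finset (Fin N) =>
          (S.card : ℝ) ≤ κ * k).card ^ 2 : ℕ) : ℝ) := by
        exact_mod_cast card_filter_lt_card_inter_le_sq k κ I hI
    _ ≤ Real.exp (κ * k * (1 - Real.log κ + X)) ^ 2 := by
        push_cast
        gcongr
    _ = Real.exp (k * (2 * (κ * (1 - Real.log κ + X)))) := by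
        rw [← Real.exp_nat_mul]
        congr 1
        push_cast
        ring
    _ ≤ _ := by
        refine Real.exp_le_exp.2 ?_
        calc (k : ℝ) * (2 * (κ * (1 - Real.log κ + X))) ≤ k * (δ * X) := by gcongr
          _ = δ * (k * X) := by ring
          _ ≤ _ := by gcongr

/-- Let `R` be the coordinates with factor at most `1 - κ`. If `R` had more than `r` elements, the
product would be at most `(1 - κ)^r ≤ η`. There are at most `2^|ι|` choices of `R`; coordinates in
`R` are free, the others lie in near-balls of size at most `b`. -/
theorem card_filter_lt_prod_le {ι Ω : Type*} [Fintype ι] [DecidableEq ι] [Fintype Ω] [Nonempty Ω]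
    (f : ι → Ω → ℝ) (hf0 : ∀ i x, 0 ≤ f i x) (hf1 : ∀ i x, f i x ≤ 1) (κ η b : ℝ)
    (hκ0 : 0 ≤ κ) (hκ1 : κ ≤ 1) (r : ℕ) (hr : (1 - κ) ^ r ≤ η) (hb1 : 1 ≤ b)
    (hb : ∀ i, ((Finset.univ.filter fun x => 1 - κ < f i x).card : ℝ) ≤ b) :
    ((Finset.univ.filter fun x : ι → Ω => η < ∏ i, f i (x i)).card : ℝ) ≤
      2 ^ Fintype.card ι * ((Fintype.card Ω : ℝ) ^ r * b ^ Fintype.card ι) := by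
  classical
  set ball : ι → Finset Ω := fun i => Finset.univ.filter fun x => 1 - κ < f i x
  set box : Finset ι → Finset (ι → Ω) := fun R =>
    Fintype.piFinset fun i => if i ∈ R then Finset.univ else ball i with hbox
  have hsub : (Finset.univ.filter fun x : ι → Ω => η < ∏ i, f i (x i)) ⊆
      (Finset.univ.filter fun R : Finset ι => R.card ≤ r).biUnion box := by
    intro x hx
    have hx' := (Finset.mem_filter.1 hx).2
    rw [Finset.mem_biUnion]
    refine ⟨Finset.univ.filter fun i => f i (x i) ≤ 1 - κ, ?_, ?_⟩
    · refine Finset.mem_filter.2 ⟨Finset.mem_univ _, ?_⟩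
      by_contra! hlt
      have h1 : ∏ i, f i (x i) ≤ ∏ i, (if f i (x i) ≤ 1 - κ then 1 - κ else 1) := by
        refine Finset.prod_le_prod (fun i _ => hf0 i _) fun i _ => ?_
        split_ifs with h
        · exact h
        · exact hf1 i _
      rw [← Finset.prod_filter, Finset.prod_const] at h1
      have h2 := pow_le_pow_of_le_one (by linarith : 0 ≤ 1 - κ) (by linarith) hlt.le
      linarith
    · rw [hbox, Fintype.mem_piFinset]
      intro i
      split_ifs with h
      · exact Finset.mem_univ _
      · simpa [ball] using h
  have hn : (1 : ℝ) ≤ Fintype.card Ω := by exact_mod_cast Fintype.card_pos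
  have hcard : ∀ R ∈ (Finset.univ.filter fun R : Finset ι => R.card ≤ r),
      ((box R).card : ℝ) ≤ (Fintype.card Ω : ℝ) ^ r * b ^ Fintype.card ι := by
    intro R hR
    have hR' := (Finset.mem_filter.1 hR).2
    rw [hbox, Fintype.card_piFinset]
    push_cast
    calc ∏ i, (((if i ∈ R then Finset.univ else ball i).card : ℕ) : ℝ)
        ≤ ∏ i, (if i ∈ R then (Fintype.card Ω : ℝ) else 1) * b := by
          refine Finset.prod_le_prod (fun i _ => by positivity) fun i _ => ?_
          split_ifs
          · rw [Finset.card_univ]; exact le_mul_of_one_le_right (by positivity) hb1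
          · rw [one_mul]; exact hb i
      _ = (Fintype.card Ω : ℝ) ^ R.card * b ^ Fintype.card ι := by
          rw [Finset.prod_mul_distrib, Finset.prod_const, Finset.card_univ, Finset.prod_ite_mem,
            Finset.univ_inter, Finset.prod_const]
      _ ≤ _ := by gcongr
  calc _ ≤ (((Finset.univ.filter fun R : Finset ι => R.card ≤ r).biUnion box).card : ℝ) := by
        exact_mod_cast Finset.card_le_card hsub
    _ ≤ ∑ R ∈ (Finset.univ.filter fun R : Finset ι => R.card ≤ r), ((box R).card : ℝ) := by
        exact_mod_cast Finset.card_biUnion_le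
    _ ≤ ∑ _R ∈ (Finset.univ.filter fun R : Finset ι => R.card ≤ r),
          (Fintype.card Ω : ℝ) ^ r * b ^ Fintype.card ι := Finset.sum_le_sum hcard
    _ ≤ ∑ _R : Finset ι, (Fintype.card Ω : ℝ) ^ r * b ^ Fintype.card ι :=
        Finset.sum_le_sum_of_subset_of_nonneg (Finset.filter_subset _ _)
          fun _ _ _ => by positivity
    _ = _ := by
        rw [Finset.sum_const, Finset.card_univ, Fintype.card_finset, nsmul_eq_mul]
        push_cast
        rfl

theorem le_choose_of_pos_of_lt (k N : ℕ) (hk : 1 ≤ k) (hkN : k < N) : N ≤ N.choose k := by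
  induction N generalizing k with
  | zero => omega
  | succ N ih =>
    obtain ⟨k, rfl⟩ : ∃ j, k = j + 1 := ⟨k - 1, by omega⟩
    rw [Nat.choose_succ_succ']
    rcases Nat.lt_or_ge (k + 1) N with h | h
    · have h1 := ih (k + 1) hk h
      have h2 : 0 < N.choose k := Nat.choose_pos (by omega)
      omega
    · obtain rfl : N = k + 1 := by omega
      simp

/-! ### Lower tail of the maximum of weakly correlated Gaussians -/

theorem stdGaussian_real_forall_inner_lt_mul_le {E : Type*} [NormedAddCommGroup E]
    [InnerProductSpace ℝ E] [FiniteDimensional ℝ E] [MeasurableSpace E] [BorelSpace E]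
    {ι : Type*} [Fintype ι] [Nonempty ι] (u : ι → E) (hu : ∀ i, ‖u i‖ = 1) (ε s D : ℝ)
    (hε0 : 0 < ε) (hε1 : ε ≤ 1) (hs : 0 ≤ s) (hD : 0 ≤ D)
    (hcard : (Fintype.card ι : ℝ) = Real.exp (s ^ 2 / 2))
    (hB : ∀ i, ({j | ε ^ 2 / 40 < inner ℝ (u i) (u j)} : Set ι).ncard ≤
      D * Real.exp (ε / 2 * (s ^ 2 / 2))) :
    (stdGaussian E).real {x | ∀ i, inner ℝ (u i) x < (1 - ε) * s} * s ≤
      2 * Real.pi * (1 + D) * Real.exp (1 + 90 / ε ^ 2) := by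
  let _ : MeasurableSpace ι := ⊤
  have : DiscreteMeasurableSpace ι := ⟨fun _ => trivial⟩
  obtain ⟨σ, hσ, hmax⟩ := exists_measurable_argmax (fun (i : ι) (x : E) => inner ℝ (u i) x)
    (fun i => by fun_prop)
  -- `l = ε s / 5` nearly minimises `(l π/2)²/2 - l ε s/2`, the second term coming from the gap `ε
  -- s/2` between the two levels.
  have hconc := stdGaussian_max_concentration u hu σ hσ hmax ((1 - ε / 2) * s) ((1 - ε) * s)
    (ε * s / 5) (by positivity)
  have eK : {x | inner ℝ (u (σ x)) x < (1 - ε) * s} = {x | ∀ i, inner ℝ (u i) x < (1 - ε) * s} :=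
    Set.ext fun x => ⟨fun h i => (hmax x i).trans_lt h, fun h => h _⟩
  have eA : {x | (1 - ε / 2) * s ≤ inner ℝ (u (σ x)) x} =
      {x | ∃ i, (1 - ε / 2) * s ≤ inner ℝ (u i) x} :=
    Set.ext fun x => ⟨fun h => ⟨_, h⟩, fun ⟨i, h⟩ => h.trans (hmax x i)⟩
  rw [eK, eA] at hconc
  set t := (1 - ε / 2) * s with ht
  have ht0 : 0 ≤ t := mul_nonneg (by linarith) hs
  have hts : t ≤ s := by nlinarith
  have hsm := one_le_stdGaussian_real_exists_le_inner_mul u hu (ε ^ 2 / 40) t _ ht0 hB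
  rw [hcard] at hsm
  set P := (stdGaussian E).real {x | ∀ i, inner ℝ (u i) x < (1 - ε) * s}
  set Q := (stdGaussian E).real {x | ∃ i, t ≤ inner ℝ (u i) x}
  have hP : 0 ≤ P := measureReal_nonneg
  have hQ : 0 ≤ Q := measureReal_nonneg
  set y := ε ^ 2 * s ^ 2 with hy
  have hy0 : 0 ≤ y := by positivity
  have hF : 2 * Real.pi * Real.exp (2 * t + 1) *
      (Real.exp (ε ^ 2 / 40 * t ^ 2) + D * Real.exp (ε / 2 * (s ^ 2 / 2)) / Real.exp (s ^ 2 / 2) *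
        Real.exp (t ^ 2 / 2)) ≤
      2 * Real.pi * Real.exp (2 * s + 1) * ((1 + D) * Real.exp (y / 40)) := by
    have h1 : Real.exp (ε ^ 2 / 40 * t ^ 2) ≤ Real.exp (y / 40) := by
      refine Real.exp_le_exp.2 ?_
      have : t ^ 2 ≤ s ^ 2 := pow_le_pow_left₀ ht0 hts 2
      have := mul_le_mul_of_nonneg_left this (sq_nonneg ε)
      linarith
    have h2 : D * Real.exp (ε / 2 * (s ^ 2 / 2)) / Real.exp (s ^ 2 / 2) * Real.exp (t ^ 2 / 2) ≤
        D * Real.exp (y / 40) := by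
      rw [mul_div_assoc, ← Real.exp_sub, mul_assoc, ← Real.exp_add]
      gcongr
      have : ε / 2 * (s ^ 2 / 2) - s ^ 2 / 2 + t ^ 2 / 2 = -(ε / 2 * (1 - ε / 2)) * (s ^ 2 / 2) := by
        rw [ht]; ring
      rw [this]
      have : 0 ≤ ε / 2 * (1 - ε / 2) * (s ^ 2 / 2) :=
        mul_nonneg (mul_nonneg (by linarith) (by linarith)) (by positivity)
      linarith
    have h3 : Real.exp (2 * t + 1) ≤ Real.exp (2 * s + 1) := Real.exp_le_exp.2 (by linarith)
    rw [one_add_mul]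
    gcongr
  have hPQ : P * Q ≤ Real.exp (-(y / 20)) := by
    have e1 : ε * s / 5 * (t - (1 - ε) * s) = y / 10 := by rw [ht, hy]; ring
    rw [e1] at hconc
    have h1 : Real.exp ((ε * s / 5 * (Real.pi / 2)) ^ 2 / 2) ≤ Real.exp (y / 20) := by
      refine Real.exp_le_exp.2 ?_
      have e2 : (ε * s / 5 * (Real.pi / 2)) ^ 2 / 2 = y * Real.pi ^ 2 / 200 := by rw [hy]; ring
      have hpi : Real.pi ^ 2 ≤ 10 := by
        have := Real.pi_lt_d2
        have := Real.pi_pos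
        nlinarith
      rw [e2]
      nlinarith
    have h2 := hconc.trans h1
    rw [← le_div_iff₀ (Real.exp_pos _), ← Real.exp_sub] at h2
    refine h2.trans_eq (congrArg _ (by ring))
  have hPle : P ≤ Real.exp (-(y / 20)) *
      (2 * Real.pi * Real.exp (2 * s + 1) * ((1 + D) * Real.exp (y / 40))) := by
    calc P = P * 1 := (mul_one P).symm
      _ ≤ P * (Q * _) := mul_le_mul_of_nonneg_left
          (hsm.trans (mul_le_mul_of_nonneg_left hF hQ)) hP
      _ = P * Q * _ := (mul_assoc _ _ _).symm
      _ ≤ _ := mul_le_mul_of_nonneg_right hPQ (by positivity)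
  have hsexp : s ≤ Real.exp s := by linarith [Real.add_one_le_exp s]
  calc P * s ≤ Real.exp (-(y / 20)) *
      (2 * Real.pi * Real.exp (2 * s + 1) * ((1 + D) * Real.exp (y / 40))) * Real.exp s := by
        gcongr
    _ = 2 * Real.pi * (1 + D) * Real.exp (-(y / 20) + (2 * s + 1) + y / 40 + s) := by
        simp only [Real.exp_add]
        ring
    _ ≤ _ := by
        refine mul_le_mul_of_nonneg_left (Real.exp_le_exp.2 ?_) (by positivity)
        -- AM–GM: the remaining quadratic decay `y / 40` absorbs `2 s` from the tail bound and `s`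
        -- from `s ≤ exp s`.
        have h5 : 3 * s ≤ y / 40 + 90 / ε ^ 2 := by
          have : y / 40 + 90 / ε ^ 2 - 3 * s = (ε ^ 2 * s - 60) ^ 2 / (40 * ε ^ 2) := by
            rw [hy]
            field_simp
            ring
          have h6 : 0 ≤ (ε ^ 2 * s - 60) ^ 2 / (40 * ε ^ 2) := by positivity
          linarith
        linarith


/-! ### Block vectors and the tensor model -/

/-- The unit vector whose inner product with a tensor `A` is the normalized sum of `A` over
`I₁ × ⋯ × I_p`. -/
noncomputable def blockVector {p N k : ℕ} (I : Fin p → {S : Finset (Fin N) // S.card = k}) :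
    EuclideanSpace ℝ (Fin p → Fin N) :=
  WithLp.toLp 2 fun i => if i ∈ Fintype.piFinset (fun j => (I j).1) then (√((k : ℝ) ^ p))⁻¹ else 0

theorem inner_blockVector {p N k : ℕ} (I : Fin p → {S : Finset (Fin N) // S.card = k})
    (A : EuclideanSpace ℝ (Fin p → Fin N)) :
    inner ℝ (blockVector I) A =
      (√((k : ℝ) ^ p))⁻¹ * ∑ i ∈ Fintype.piFinset (fun j => (I j).1), A i := by
  rw [PiLp.inner_apply, Finset.mul_sum, ← Finset.univ_inter (Fintype.piFinset _),
    ← Finset.sum_ite_mem]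
  refine Finset.sum_congr rfl fun i _ => ?_
  simp only [blockVector, Real.inner_apply]
  split_ifs <;> simp

theorem inner_blockVector_blockVector {p N k : ℕ}
    (I J : Fin p → {S : Finset (Fin N) // S.card = k}) :
    inner ℝ (blockVector I) (blockVector J) = ∏ j, (((I j).1 ∩ (J j).1).card : ℝ) / k := by
  have hinter : Fintype.piFinset (fun j => (I j).1) ∩ Fintype.piFinset (fun j => (J j).1) =
      Fintype.piFinset (fun j => (I j).1 ∩ (J j).1) := by
    ext i
    simp [Fintype.mem_piFinset, forall_and]
  rw [inner_blockVector]
  simp only [blockVector]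
  rw [Finset.sum_ite_mem, hinter, Finset.sum_const, Fintype.card_piFinset, nsmul_eq_mul,
    Finset.prod_div_distrib, Finset.prod_const, Finset.card_univ, Fintype.card_fin, mul_left_comm,
    ← mul_inv, Real.mul_self_sqrt (by positivity), ← div_eq_mul_inv]
  push_cast
  rfl

theorem norm_blockVector {p N k : ℕ} (hk : 1 ≤ k)
    (I : Fin p → {S : Finset (Fin N) // S.card = k}) : ‖blockVector I‖ = 1 := by
  have h := real_inner_self_eq_norm_sq (blockVector I)
  have hk' : (k : ℝ) ≠ 0 := by positivity
  rw [inner_blockVector_blockVector] at h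
  simp only [Finset.inter_self, (I _).2, div_self hk', Finset.prod_const_one] at h
  nlinarith [norm_nonneg (blockVector I)]

/-- The two spaces correspond by a measurable equivalence, so `P` need not be measurable. -/
theorem gaussianTensor_real_eq {p N : ℕ} (P : ((Fin p → Fin N) → ℝ) → Prop) :
    (gaussianTensor p N).real {A | P A} =
      (stdGaussian (EuclideanSpace ℝ (Fin p → Fin N))).real {x | P (WithLp.ofLp x)} := by
  rw [← map_pi_eq_stdGaussian, measureReal_def, measureReal_def]
  rw [show (WithLp.toLp 2 : ((Fin p → Fin N) → ℝ) → _) =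
    (MeasurableEquiv.toLp 2 ((Fin p → Fin N) → ℝ)) from rfl, MeasurableEquiv.map_apply]
  rfl

theorem subtensorAverage_eq {p N k : ℕ} (I : Fin p → {S : Finset (Fin N) // S.card = k})
    (x : EuclideanSpace ℝ (Fin p → Fin N)) :
    subtensorAverage k (WithLp.ofLp x) (fun j => (I j).1) =
      inner ℝ (blockVector I) x * (√((k : ℝ) ^ p))⁻¹ := by
  have h : (√((k : ℝ) ^ p))⁻¹ * (√((k : ℝ) ^ p))⁻¹ = 1 / (k : ℝ) ^ p := by
    rw [← mul_inv, Real.mul_self_sqrt (by positivity), one_div]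
  rw [subtensorAverage, inner_blockVector, mul_right_comm, h]

theorem Emax_eq (p N k : ℕ) :
    Emax p N k = √(2 * (p * Real.log (N.choose k))) * (√((k : ℝ) ^ p))⁻¹ := by
  rw [Emax, div_mul_eq_mul_div, mul_assoc, Real.sqrt_div', div_eq_mul_inv]
  positivity

theorem le_maxSubtensorAverage {p N k : ℕ} (a : ℝ)
    (x : EuclideanSpace ℝ (Fin p → Fin N)) (I : Fin p → {S : Finset (Fin N) // S.card = k})
    (h : a ≤ inner ℝ (blockVector I) x) :
    a * (√((k : ℝ) ^ p))⁻¹ ≤ maxSubtensorAverage k (WithLp.ofLp x) := by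
  have h1 := le_ciSup (Set.finite_range
    fun J : {I : Fin p → Finset (Fin N) // ∀ j, (I j).card = k} =>
      subtensorAverage k (WithLp.ofLp x) J.1).bddAbove ⟨fun j => (I j).1, fun j => (I j).2⟩
  refine le_trans ?_ h1
  rw [subtensorAverage_eq]
  gcongr

theorem maxSubtensorAverage_le {p N k : ℕ} (hkN : k ≤ N) (b : ℝ)
    (x : EuclideanSpace ℝ (Fin p → Fin N))
    (h : ∀ I : Fin p → {S : Finset (Fin N) // S.card = k}, inner ℝ (blockVector I) x ≤ b) :
    maxSubtensorAverage k (WithLp.ofLp x) ≤ b * (√((k : ℝ) ^ p))⁻¹ := by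
  obtain ⟨S, -, hS⟩ := Finset.exists_subset_card_eq
    (show k ≤ (Finset.univ : Finset (Fin N)).card by simpa using hkN)
  have : Nonempty {I : Fin p → Finset (Fin N) // ∀ j, (I j).card = k} :=
    ⟨⟨fun _ => S, fun _ => hS⟩⟩
  refine ciSup_le fun J => ?_
  have := subtensorAverage_eq (fun j => (⟨J.1 j, J.2 j⟩ : {S : Finset (Fin N) // S.card = k})) x
  simp only at this
  rw [this]
  gcongr
  exact h _

/-- Union bound for the maximum of `exp (s ^ 2 / 2)` standard normal variables. -/
theorem stdGaussian_real_exists_lt_inner_le {E : Type*} [NormedAddCommGroup E]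
    [InnerProductSpace ℝ E] [FiniteDimensional ℝ E] [MeasurableSpace E] [BorelSpace E]
    {ι : Type*} [Fintype ι] (u : ι → E) (hu : ∀ i, ‖u i‖ = 1) (s : ℝ) (hs : 0 < s)
    (hcard : (Fintype.card ι : ℝ) = Real.exp (s ^ 2 / 2)) :
    (stdGaussian E).real {x | ∃ i, s < inner ℝ (u i) x} ≤ 1 / s := by
  have h1 : {x | ∃ i, s < inner ℝ (u i) x} = ⋃ i, {x : E | inner ℝ (u i) x ∈ Set.Ioi s} := by
    ext; simp
  rw [h1]
  refine (measureReal_iUnion_fintype_le _).trans ?_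
  calc ∑ i, (stdGaussian E).real {x : E | inner ℝ (u i) x ∈ Set.Ioi s}
      ≤ ∑ _i : ι, Real.exp (-s ^ 2 / 2) / s := by
        refine Finset.sum_le_sum fun i _ => ?_
        rw [stdGaussian_real_inner_mem (u i) (hu i) _ measurableSet_Ioi]
        exact gaussianReal_Ioi_le s hs
    _ = 1 / s := by
        rw [Finset.sum_const, Finset.card_univ, nsmul_eq_mul, hcard, mul_div_assoc', ← Real.exp_add]
        congr 1
        rw [Real.exp_eq_one_iff]
        ring

theorem exists_ncard_lt_inner_blockVector_le (ε η q : ℝ) (hε : 0 < ε) (hη : 0 < η) (hq0 : 0 < q)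
    (hq1 : q < 1) :
    ∃ P : ℕ, ∀ p : ℕ, P ≤ p → ∀ N k : ℕ, 1 ≤ k → (k : ℝ) ≤ q * N →
      ∀ I : Fin p → {S : Finset (Fin N) // S.card = k},
        ({J | η < inner ℝ (blockVector I) (blockVector J)} :
          Set (Fin p → {S : Finset (Fin N) // S.card = k})).ncard ≤
        (2 : ℝ) ^ p * Real.exp (ε * (p * Real.log (N.choose k))) := by
  obtain ⟨κ, hκ0, hκ1, hball⟩ :=
    exists_card_filter_lt_card_inter_le_exp (ε / 2) q (by positivity) hq0 hq1
  obtain ⟨r, hr⟩ := exists_pow_lt_of_lt_one hη (show 1 - κ < 1 by linarith)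
  -- `p ≥ r / (ε/2)` makes the free coordinates cost at most `n^r ≤ n^(pε/2)`, where `n = N.choose
  -- k`; the near-balls cost the other `n^(pε/2)`.
  obtain ⟨P, hP⟩ := exists_nat_ge (r / (ε / 2))
  refine ⟨P, fun p hp N k hk hkN I => ?_⟩
  have hk' : (0 : ℝ) < k := by exact_mod_cast hk
  have hkN' : k ≤ N := by
    have : (k : ℝ) ≤ N := hkN.trans (mul_le_of_le_one_left (by positivity) hq1.le)
    exact_mod_cast this
  have hn : 1 ≤ N.choose k := Nat.choose_pos hkN'
  have hn' : (1 : ℝ) ≤ N.choose k := by exact_mod_cast hn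
  have hlog : 0 ≤ Real.log (N.choose k) := Real.log_nonneg hn'
  have hcard : Fintype.card {S : Finset (Fin N) // S.card = k} = N.choose k := by
    simp
  have : Nonempty {S : Finset (Fin N) // S.card = k} :=
    Fintype.card_pos_iff.1 (by rw [hcard]; exact hn)
  have hle1 : ∀ (j : Fin p) (S : {S : Finset (Fin N) // S.card = k}),
      (((I j).1 ∩ S.1).card : ℝ) / k ≤ 1 := by
    intro j S
    rw [div_le_one hk']
    have := Finset.card_le_card (Finset.inter_subset_left (s₁ := (I j).1) (s₂ := S.1))
    rw [(I j).2] at this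
    exact_mod_cast this
  have hmain := card_filter_lt_prod_le
    (fun (j : Fin p) (S : {S : Finset (Fin N) // S.card = k}) => (((I j).1 ∩ S.1).card : ℝ) / k)
    (fun _ _ => by positivity) hle1 κ η (Real.exp (ε / 2 * Real.log (N.choose k))) hκ0.le hκ1.le r
    hr.le (Real.one_le_exp (by positivity)) (fun j => by
      simp only [lt_div_iff₀ hk']
      exact hball N k hk hkN (I j).1 (I j).2)
  have hset : ({J | η < inner ℝ (blockVector I) (blockVector J)} :
      Set (Fin p → {S : Finset (Fin N) // S.card = k})) =
      ((Finset.univ.filter fun J : Fin p → {S : Finset (Fin N) // S.card = k} =>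
        η < ∏ j, (((I j).1 ∩ (J j).1).card : ℝ) / k : Finset _) : Set _) := by
    ext J
    simp [inner_blockVector_blockVector]
  rw [hset, Set.ncard_coe_finset]
  refine hmain.trans ?_
  rw [Fintype.card_fin, hcard]
  gcongr
  have hnexp : (N.choose k : ℝ) = Real.exp (Real.log (N.choose k)) :=
    (Real.exp_log (by linarith)).symm
  rw [hnexp, Real.log_exp, ← Real.exp_nat_mul, ← Real.exp_nat_mul, ← Real.exp_add]
  refine Real.exp_le_exp.2 ?_
  have hpr : (r : ℝ) ≤ p * (ε / 2) := by
    rw [← div_le_iff₀ (by positivity)]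
    exact hP.trans (by exact_mod_cast hp)
  nlinarith [mul_le_mul_of_nonneg_right hpr hlog]

/-! ### Assembly of the two tails and the limit -/

theorem exists_one_sub_div_sqrt_log_choose_le (ε : ℝ) (hε : 0 < ε) (q : ℝ) (hq0 : 0 < q)
    (hq1 : q < 1) :
    ∃ P : ℕ, ∀ p : ℕ, P ≤ p → ∃ C : ℝ, 0 < C ∧ ∀ N k : ℕ, 1 ≤ k → (k : ℝ) ≤ q * N →
      0 < Real.log (N.choose k) →
      1 - C / √(Real.log (N.choose k : ℝ)) ≤
        (gaussianTensor p N).real {A | (1 - ε) * Emax p N k ≤ maxSubtensorAverage k A ∧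
          maxSubtensorAverage k A ≤ Emax p N k} := by
  -- The lower tail estimate needs `ε ≤ 1`; replacing `ε` by a smaller value only strengthens the
  -- conclusion.
  set e := min ε 1 with he
  have he0 : 0 < e := lt_min hε one_pos
  have he1 : e ≤ 1 := min_le_right _ _
  have heε : e ≤ ε := min_le_left _ _
  obtain ⟨P, hP⟩ := exists_ncard_lt_inner_blockVector_le (e / 2) (e ^ 2 / 40) q (by positivity)
    (by positivity) hq0 hq1
  refine ⟨max P 1, fun p hp => ?_⟩
  set K := 2 * Real.pi * (1 + (2 : ℝ) ^ p) * Real.exp (1 + 90 / e ^ 2) with hK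
  have hKpos : 0 < K := by positivity
  -- `K` pays for the lower tail and `1` for the union bound.
  refine ⟨K + 1, by positivity, fun N k hk hkN hlog => ?_⟩
  have hp1 : (1 : ℝ) ≤ p := by exact_mod_cast (le_max_right P 1).trans hp
  have hkN' : k ≤ N := by
    have : (k : ℝ) ≤ N := hkN.trans (mul_le_of_le_one_left (by positivity) hq1.le)
    exact_mod_cast this
  set Ω := {S : Finset (Fin N) // S.card = k}
  set E := EuclideanSpace ℝ (Fin p → Fin N)
  have hcardΩ : Fintype.card Ω = N.choose k := by simp [Ω]
  have hn : 0 < N.choose k := Nat.choose_pos hkN'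
  have : Nonempty Ω := Fintype.card_pos_iff.1 (by rw [hcardΩ]; exact hn)
  set s := √(2 * (p * Real.log (N.choose k))) with hs
  have hs2 : s ^ 2 / 2 = p * Real.log (N.choose k) := by
    rw [hs, Real.sq_sqrt (by positivity)]; ring
  have hs0 : 0 < s := Real.sqrt_pos.2 (by positivity)
  have hcard : (Fintype.card (Fin p → Ω) : ℝ) = Real.exp (s ^ 2 / 2) := by
    rw [hs2, Real.exp_nat_mul, Real.exp_log (by exact_mod_cast hn), Fintype.card_fun, hcardΩ,
      Fintype.card_fin]
    push_cast
    rfl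
  have hnorm : ∀ I : Fin p → Ω, ‖blockVector I‖ = 1 := norm_blockVector hk
  have hlow := stdGaussian_real_forall_inner_lt_mul_le (blockVector : (Fin p → Ω) → E) hnorm e s
    (2 ^ p) he0 he1 hs0.le (by positivity) hcard (fun I => by
      rw [hs2]; exact hP p ((le_max_left P 1).trans hp) N k hk hkN I)
  rw [← le_div_iff₀ hs0] at hlow
  have hup := stdGaussian_real_exists_lt_inner_le (blockVector : (Fin p → Ω) → E) hnorm s hs0 hcard
  rw [gaussianTensor_real_eq]
  set G : Set E := {x | (1 - ε) * Emax p N k ≤ maxSubtensorAverage k (WithLp.ofLp x) ∧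
    maxSubtensorAverage k (WithLp.ofLp x) ≤ Emax p N k}
  set U : Set E := {x | ∀ I : Fin p → Ω, inner ℝ (blockVector I) x < (1 - e) * s}
  set V : Set E := {x | ∃ I : Fin p → Ω, s < inner ℝ (blockVector I) x}
  have hcover : (Set.univ : Set E) ⊆ G ∪ (U ∪ V) := by
    intro x _
    by_contra hx
    simp only [Set.mem_union, not_or] at hx
    obtain ⟨hG, hU, hV⟩ := hx
    simp only [U, V, Set.mem_ofPred_eq, not_forall, not_exists, not_lt] at hU hV
    obtain ⟨I, hI⟩ := hU
    refine hG ⟨?_, ?_⟩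
    · refine le_trans ?_ (le_maxSubtensorAverage _ x I hI)
      rw [Emax_eq, ← mul_assoc]
      gcongr
    · rw [Emax_eq]
      exact maxSubtensorAverage_le hkN' _ x hV
  have hsum : 1 ≤ (stdGaussian E).real G +
      ((stdGaussian E).real U + (stdGaussian E).real V) := by
    calc (1 : ℝ) = (stdGaussian E).real Set.univ := probReal_univ.symm
      _ ≤ (stdGaussian E).real (G ∪ (U ∪ V)) := measureReal_mono hcover
      _ ≤ _ := (measureReal_union_le _ _).trans
          (add_le_add_right (measureReal_union_le _ _) _)
  have hsqrt : √(Real.log (N.choose k)) ≤ s := by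
    refine Real.sqrt_le_sqrt ?_
    nlinarith
  have hdiv : (K + 1) / s ≤ (K + 1) / √(Real.log (N.choose k)) := by
    have := Real.sqrt_pos.2 hlog
    gcongr
  rw [add_div] at hdiv
  linarith

theorem theorem3p1 (ε : ℝ) (hε : 0 < ε) (c : ℝ) (hc : c < 1) :
    ∃ Pstar : ℕ, ∀ p : ℕ, Pstar ≤ p → ∃ C : ℝ, 0 < C ∧
      ∀ k : ℕ → ℕ, (∀ᶠ N : ℕ in atTop, 1 ≤ k N ∧ k N ≤ N) →
        limsup (fun N : ℕ => (k N : ℝ) / (N : ℝ)) atTop ≤ c →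
        (∀ᶠ N : ℕ in atTop,
          1 - C / √(Real.log (N.choose (k N) : ℝ)) ≤
            (gaussianTensor p N).real
              {A | (1 - ε) * Emax p N (k N) ≤ maxSubtensorAverage (k N) A ∧
                maxSubtensorAverage (k N) A ≤ Emax p N (k N)}) ∧
        Tendsto (fun N : ℕ =>
            (gaussianTensor p N).real
              {A | (1 - ε) * Emax p N (k N) ≤ maxSubtensorAverage (k N) A ∧
                maxSubtensorAverage (k N) A ≤ Emax p N (k N)}) atTop (𝓝 1) := by
  -- Strictly between `c` and `1`, so eventually `k ≤ q N`; the `max` keeps `q` positive when `c` is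
  -- negative.
  set q := (max c 0 + 1) / 2 with hq
  have hmax1 : max c 0 < 1 := max_lt hc one_pos
  have hmax0 : 0 ≤ max c 0 := le_max_right _ _
  have hcmax : c ≤ max c 0 := le_max_left _ _
  obtain ⟨P, hP⟩ := exists_one_sub_div_sqrt_log_choose_le ε hε q (by linarith) (by linarith)
  refine ⟨P, fun p hp => ?_⟩
  obtain ⟨C, hC, hbound⟩ := hP p hp
  refine ⟨C, hC, fun k hk hlim => ?_⟩
  -- A real `limsup` carries information only for sequences bounded above.
  have hbdd : IsBoundedUnder (· ≤ ·) atTop fun N : ℕ => (k N : ℝ) / (N : ℝ) := by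
    refine isBoundedUnder_of_eventually_le (a := 1) ?_
    filter_upwards [hk] with N hN
    exact div_le_one_of_le₀ (by exact_mod_cast hN.2) (by positivity)
  have hev : ∀ᶠ N : ℕ in atTop, (k N : ℝ) / (N : ℝ) < q :=
    eventually_lt_of_limsup_lt (by linarith) hbdd
  have hregime : ∀ᶠ N : ℕ in atTop, 1 ≤ k N ∧ k N < N ∧ (k N : ℝ) ≤ q * N := by
    filter_upwards [hk, hev, eventually_gt_atTop 0] with N h1 h2 h3
    have h3' : (0 : ℝ) < N := by exact_mod_cast h3
    rw [div_lt_iff₀ h3'] at h2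
    have h4 : (k N : ℝ) < N := by nlinarith
    exact ⟨h1.1, by exact_mod_cast h4, h2.le⟩
  have hlogtop : Tendsto (fun N : ℕ => Real.log (N.choose (k N) : ℝ)) atTop atTop := by
    refine tendsto_atTop_mono' atTop ?_ (Real.tendsto_log_atTop.comp tendsto_natCast_atTop_atTop)
    filter_upwards [hregime, eventually_gt_atTop 0] with N h1 h2
    exact Real.log_le_log (by exact_mod_cast h2)
      (by exact_mod_cast le_choose_of_pos_of_lt (k N) N h1.1 h1.2.1)
  have hfirst : ∀ᶠ N : ℕ in atTop,
      1 - C / √(Real.log (N.choose (k N) : ℝ)) ≤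
        (gaussianTensor p N).real
          {A | (1 - ε) * Emax p N (k N) ≤ maxSubtensorAverage (k N) A ∧
            maxSubtensorAverage (k N) A ≤ Emax p N (k N)} := by
    filter_upwards [hregime, hlogtop.eventually_gt_atTop 0] with N h1 h2
    exact hbound N (k N) h1.1 h1.2.2 h2
  refine ⟨hfirst, ?_⟩
  have hlower : Tendsto (fun N : ℕ => 1 - C / √(Real.log (N.choose (k N) : ℝ))) atTop (𝓝 1) := by
    simpa using ((Real.tendsto_sqrt_atTop.comp hlogtop).const_div_atTop C).const_sub 1
  refine tendsto_of_tendsto_of_tendsto_of_le_of_le' hlower tendsto_const_nhds hfirst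
    (Eventually.of_forall fun N => ?_)
  have : IsProbabilityMeasure (gaussianTensor p N) := by
    rw [gaussianTensor]; infer_instance
  exact measureReal_le_one
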